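/- For $z\in\mathbb{C}$ let $[z]=\lfloor \mathrm{Re}(z)+\tfrac12\rfloor+i\lfloor \mathrm{Im}(z)+\tfrac12\rfloor$, let $\mathfrak{F}=\{z\in\mathbb{C}:[z]=0\}$, and let $T:\mathfrak{F}\to\mathfrak{F}$ be given by $T(0)=0$ and $T(z)=z^{-1}-[z^{-1}]$ for $z\neq 0$. For $z\in\mathfrak{F}$ and $n\geq 1$ with $T^{n-1}(z)\neq 0$, put $a_n(z)=[1/T^{n-1}(z)]$; these are the partial quotients of the Hurwitz continued fraction of $z$. Let $\mathscr{D}=\{a\in\mathbb{Z}[i]:|a|\geq\sqrt2\}$. A word $(a_1,\ldots,a_n)\in\mathscr{D}^n$ is regular if its cylinder $$\mathcal{C}_n(a_1,\ldots,a_n)=\{z\in\mathfrak{F}: a_1(z)=a_1,\ldots,a_n(z)=a_n\}$$ has non-empty interior in $\mathbb{C}$. Let $\Omega$ be the set of sequences $(a_n)_{n\geq1}\in\mathscr{D}^{\mathbb{N}}$ that are the infinite Hurwitz continued fraction expansion of some $z\in\mathfrak{F}$ (i.e. $a_n(z)$ exists and equals $a_n$ for all $n\ge 1$), and let $\mathsf{R}$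 be the set of all $(a_n)_{n\geq1}\in\Omega$ such that $(a_1,\ldots,a_n)$ is regular for every $n\geq 1$. Give $\mathbb{Z}[i]^{\mathbb{N}}$ the product of the discrete topologies. For every $a=(a_n)_{n\ge1}\in\Omega$ the limit $$\Lambda(a)=[0;a_1,a_2,\ldots]=\lim_{n\to\infty}\cfrac{1}{a_1+\cfrac{1}{\ddots+\cfrac{1}{a_n}}}$$ exists, lies in $\mathfrak{F}$, and has $a$ as its Hurwitz continued fraction expansion. There exists a unique continuous map $\overline{\Lambda}:\overline{\mathsf{R}}\to\mathbb{C}$ on the closure $\overline{\mathsf{R}}$ of $\mathsf{R}$ in $\mathbb{Z}[i]^{\mathbb{N}}$ that extends the restriction $\Lambda|_{\mathsf{R}}$. It takes values in the closure of $\mathfrak{F}$, and its image contains $\mathfrak{F}\setminus\mathbb{Q}(i)$. -/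

import Mathlib

open Filter Topology

/-- The Gaussian integers carry the discrete topology, so that `ℕ → GaussianInt` carries the
product topology of the sequence space `ℤ[i]^ℕ`. -/
instance instTopologicalSpaceGaussianInt : TopologicalSpace GaussianInt := ⊥

instance instDiscreteTopologyGaussianInt : DiscreteTopology GaussianInt := ⟨rfl⟩

namespace HurwitzCF

noncomputable section

/-- The nearest Gaussian integer `[z] = ⌊Re z + 1/2⌋ + i ⌊Im z + 1/2⌋`. -/
def nearest (z : ℂ) : GaussianInt := ⟨⌊z.re + 1 / 2⌋, ⌊z.im + 1 / 2⌋⟩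

/-- The half-open unit square `𝔉 = {z : [z] = 0}`. -/
def square : Set ℂ := {z | nearest z = 0}

open Classical in
/-- The complex Gauss map `T z = z⁻¹ - [z⁻¹]` for `z ≠ 0`, and `T 0 = 0`. -/
def gaussMap (z : ℂ) : ℂ := if z = 0 then 0 else z⁻¹ - (nearest z⁻¹ : ℂ)

/-- The alphabet `𝒟` of Gaussian integers of absolute value at least `√2`. -/
def alphabet : Set GaussianInt := {a | Real.sqrt 2 ≤ ‖(a : ℂ)‖}

/-- `HasDigit z n a`: the `(n+1)`-st partial quotient of `z` exists (that is, `T^n z ≠ 0`) and it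
is `a`, i.e. `a = [(T^n z)⁻¹]`.  Positions are counted from `0`. -/
def HasDigit (z : ℂ) (n : ℕ) (a : GaussianInt) : Prop :=
  gaussMap^[n] z ≠ 0 ∧ nearest (gaussMap^[n] z)⁻¹ = a

/-- The cylinder of level `n` based on the word `a`. -/
def cylinder {n : ℕ} (a : Fin n → GaussianInt) : Set ℂ :=
  {z | z ∈ square ∧ ∀ k : Fin n, HasDigit z k (a k)}

/-- A word over the alphabet is regular if its cylinder has non-empty interior. -/
def IsRegularWord {n : ℕ} (a : Fin n → GaussianInt) : Prop :=
  (∀ k, a k ∈ alphabet) ∧ (interior (cylinder a)).Nonempty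

/-- The infinite sequence `a` is the Hurwitz continued fraction expansion of `z ∈ 𝔉`. -/
def IsExpansion (a : ℕ → GaussianInt) (z : ℂ) : Prop :=
  z ∈ square ∧ ∀ n, HasDigit z n (a n)

/-- The set `Ω` of valid sequences. -/
def validSeq : Set (ℕ → GaussianInt) :=
  {a | (∀ n, a n ∈ alphabet) ∧ ∃ z, IsExpansion a z}

/-- The set `R` of regular sequences: valid, with every non-empty prefix regular. -/
def regularSeq : Set (ℕ → GaussianInt) :=
  {a | a ∈ validSeq ∧ ∀ n : ℕ, 1 ≤ n → IsRegularWord (fun k : Fin n => a k)}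

/-- The finite continued fraction `[0; a 0, …, a (n-1)]`. -/
def convergent : ℕ → (ℕ → GaussianInt) → ℂ
  | 0, _ => 0
  | n + 1, a => ((a 0 : ℂ) + convergent n (fun k => a (k + 1)))⁻¹

/-- The map `Λ : a ↦ [0; a 0, a 1, …] = lim_n [0; a 0, …, a (n-1)]` on valid sequences. -/
def value (a : validSeq) : ℂ := limUnder atTop (fun n => convergent n a.1)

/-- The field `ℚ(i)`, as a set of complex numbers. -/
def gaussianRationals : Set ℂ := {z | ∃ p q : ℚ, z = (p : ℂ) + (q : ℂ) * Complex.I}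

/-- `L` is a continuous extension of `Λ|_R` to the closure of `R` in `ℤ[i]^ℕ`. -/
def IsContinuousExtension (L : closure regularSeq → ℂ) : Prop :=
  Continuous L ∧
    ∀ (a : ℕ → GaussianInt) (ha : a ∈ regularSeq), L ⟨a, subset_closure ha⟩ = value ⟨a, ha.1⟩

end

end HurwitzCF

namespace HurwitzCF

open MeasureTheory

/-! ### The nearest Gaussian integer and the unit square -/

/-! Everything rests on one uniform estimate. With `p/q` the `n`-th convergent of `z`, `q z - p` is
up to sign the product of `z, T z, …, T^n z`, each of norm at most `√(1/2)`. Since `q` is a nonzero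
Gaussian integer, `|q| ≥ 1`, so the convergents approach `z` at a rate independent of the sequence
(`IsExpansion.dist_convergent_le`).

Each convergent is locally constant in the sequence, so the resulting Cauchy bound passes to the
closure of `R`. There the convergents converge uniformly, and their limit is the continuous
extension; density of `R` gives uniqueness.

For the image, points whose orbit avoids the discontinuities of `T` have regular expansions, and
they are dense because the exceptional set is null. Given `z` outside `ℚ(i)`, take an ultrafilter of
such points converging to `z`. Along it each iterate of `T` converges to a point outside `ℚ(i)`,
hence nonzero, so each digit takes finitely many values and stabilises. The limiting digit sequence
lies in the closure of `R`, and continuity sends it to `z`. -/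

theorem mem_square_iff {z : ℂ} :
    z ∈ square ↔ (-(1 / 2) ≤ z.re ∧ z.re < 1 / 2) ∧ -(1 / 2) ≤ z.im ∧ z.im < 1 / 2 := by
  have h : z ∈ square ↔ ⌊z.re + 1 / 2⌋ = 0 ∧ ⌊z.im + 1 / 2⌋ = 0 := by
    simp [square, nearest, Zsqrtd.ext_iff]
  rw [h, Int.floor_eq_zero_iff, Int.floor_eq_zero_iff, Set.mem_Ico, Set.mem_Ico]
  constructor
  · rintro ⟨⟨h1, h2⟩, h3, h4⟩
    refine ⟨⟨?_, ?_⟩, ?_, ?_⟩ <;> linarith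
  · rintro ⟨⟨h1, h2⟩, h3, h4⟩
    refine ⟨⟨?_, ?_⟩, ?_, ?_⟩ <;> linarith

theorem re_nearest (z : ℂ) : ((nearest z : ℂ)).re = (⌊z.re + 1 / 2⌋ : ℝ) := by
  simp [nearest, GaussianInt.toComplex_def']

theorem im_nearest (z : ℂ) : ((nearest z : ℂ)).im = (⌊z.im + 1 / 2⌋ : ℝ) := by
  simp [nearest, GaussianInt.toComplex_def']

theorem sub_nearest_mem_square (z : ℂ) : z - (nearest z : ℂ) ∈ square := by
  rw [mem_square_iff, Complex.sub_re, Complex.sub_im, re_nearest, im_nearest]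
  have h1 := Int.floor_le (z.re + 1 / 2)
  have h2 := Int.lt_floor_add_one (z.re + 1 / 2)
  have h3 := Int.floor_le (z.im + 1 / 2)
  have h4 := Int.lt_floor_add_one (z.im + 1 / 2)
  refine ⟨⟨?_, ?_⟩, ?_, ?_⟩ <;> linarith

theorem gaussMap_mem_square (z : ℂ) : gaussMap z ∈ square := by
  unfold gaussMap
  split_ifs
  · rw [mem_square_iff]; norm_num
  · exact sub_nearest_mem_square _

theorem iterate_gaussMap_mem_square {z : ℂ} (hz : z ∈ square) (n : ℕ) :
    gaussMap^[n] z ∈ square := by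
  cases n with
  | zero => exact hz
  | succ n => rw [Function.iterate_succ_apply']; exact gaussMap_mem_square _

theorem gaussMap_of_ne_zero {z : ℂ} (hz : z ≠ 0) : gaussMap z = z⁻¹ - (nearest z⁻¹ : ℂ) :=
  if_neg hz

theorem normSq_le_of_mem_square {z : ℂ} (hz : z ∈ square) : Complex.normSq z ≤ 1 / 2 := by
  obtain ⟨⟨h1, h2⟩, h3, h4⟩ := mem_square_iff.1 hz
  rw [Complex.normSq_apply]
  nlinarith

theorem norm_le_of_mem_square {z : ℂ} (hz : z ∈ square) : ‖z‖ ≤ √(1 / 2) := by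
  apply Real.le_sqrt_of_sq_le
  rw [← Complex.normSq_eq_norm_sq]
  exact normSq_le_of_mem_square hz

theorem sqrt_half_lt_one : √(1 / 2 : ℝ) < 1 := by
  rw [Real.sqrt_lt' one_pos]; norm_num

theorem normSq_toComplex (a : GaussianInt) :
    Complex.normSq (a : ℂ) = ((a.re * a.re + a.im * a.im : ℤ) : ℝ) := by
  simp [Complex.normSq_apply]

theorem one_le_norm_toComplex {a : GaussianInt} (ha : a ≠ 0) : 1 ≤ ‖(a : ℂ)‖ := by
  have h : 0 < a.re * a.re + a.im * a.im := by
    by_contra h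
    apply ha
    have h1 : a.re = 0 := by nlinarith [mul_self_nonneg a.re, mul_self_nonneg a.im]
    have h2 : a.im = 0 := by nlinarith [mul_self_nonneg a.re, mul_self_nonneg a.im]
    exact Zsqrtd.ext h1 h2
  have h' : (1 : ℝ) ≤ ‖(a : ℂ)‖ ^ 2 := by
    rw [← Complex.normSq_eq_norm_sq, normSq_toComplex]
    exact_mod_cast h
  nlinarith [norm_nonneg (a : ℂ)]

/-- The partial quotients of a point of the square lie in the alphabet. -/
theorem nearest_inv_mem_alphabet {w : ℂ} (hw : w ∈ square) (h0 : w ≠ 0) :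
    nearest w⁻¹ ∈ alphabet := by
  set a := nearest w⁻¹ with ha
  have hv := normSq_le_of_mem_square (sub_nearest_mem_square w⁻¹)
  rw [← ha] at hv
  have hwn := normSq_le_of_mem_square hw
  have hpos : 0 < Complex.normSq w := Complex.normSq_pos.2 h0
  have hprod : Complex.normSq (1 - w * a) ≤ Complex.normSq w / 2 := by
    have : 1 - w * (a : ℂ) = w * (w⁻¹ - a) := by field_simp
    rw [this, Complex.normSq_mul]
    nlinarith
  obtain ⟨⟨h1, h2⟩, h3, h4⟩ := mem_square_iff.1 hw
  -- The smaller candidates are `0` and the four units. For a unit `a`, `hprod` reads `1 - 2 Re (w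
  -- a) + |w|² / 2 ≤ 0`, impossible since `Re (w a) ≤ 1/2` on the square and `w ≠ 0`; for `a = 0` it
  -- contradicts `|w|² ≤ 1/2`.
  have key : 2 ≤ a.re * a.re + a.im * a.im := by
    by_contra hlt
    have b1 : -1 ≤ a.re := by nlinarith [mul_self_nonneg a.im]
    have b2 : a.re ≤ 1 := by nlinarith [mul_self_nonneg a.im]
    have b3 : -1 ≤ a.im := by nlinarith [mul_self_nonneg a.re]
    have b4 : a.im ≤ 1 := by nlinarith [mul_self_nonneg a.re]
    simp only [Complex.normSq_apply, Complex.sub_re, Complex.sub_im, Complex.mul_re,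
      Complex.mul_im, Complex.one_re, Complex.one_im, ← GaussianInt.intCast_re,
      ← GaussianInt.intCast_im] at hprod hpos hwn
    have c1 : a.re = -1 ∨ a.re = 0 ∨ a.re = 1 := by omega
    have c2 : a.im = -1 ∨ a.im = 0 ∨ a.im = 1 := by omega
    rcases c1 with c1 | c1 | c1 <;> rcases c2 with c2 | c2 | c2 <;>
      first
      | (rw [c1, c2] at hlt; norm_num at hlt; done)
      | (rw [c1, c2] at hprod; push_cast at hprod; nlinarith)
  rw [alphabet, Set.mem_ofPred_eq]
  apply Real.sqrt_le_iff.2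
  refine ⟨norm_nonneg _, ?_⟩
  rw [← Complex.normSq_eq_norm_sq, normSq_toComplex]
  exact_mod_cast key

/-! ### Convergence -/

/-- Numerator and denominator of the `n`-th convergent. -/
def numDen : ℕ → (ℕ → GaussianInt) → GaussianInt × GaussianInt
  | 0, _ => (0, 1)
  | n + 1, a =>
    ((numDen n fun k => a (k + 1)).2,
      a 0 * (numDen n fun k => a (k + 1)).2 + (numDen n fun k => a (k + 1)).1)

theorem IsExpansion.shift {a : ℕ → GaussianInt} {z : ℂ} (h : IsExpansion a z) :
    IsExpansion (fun k => a (k + 1)) (gaussMap z) :=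
  ⟨gaussMap_mem_square z, fun n => by
    have := h.2 (n + 1)
    rwa [HasDigit, Function.iterate_succ_apply] at this⟩

theorem IsExpansion.ne_zero {a : ℕ → GaussianInt} {z : ℂ} (h : IsExpansion a z) : z ≠ 0 :=
  (h.2 0).1

theorem IsExpansion.gaussMap_eq {a : ℕ → GaussianInt} {z : ℂ} (h : IsExpansion a z) :
    gaussMap z = z⁻¹ - (a 0 : ℂ) := by
  rw [gaussMap_of_ne_zero h.ne_zero, ← (h.2 0).2, Function.iterate_zero_apply]

/-- Prepending a digit multiplies the linear form `q z - p` of the tail, taken at `T z`, by `-z`. -/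
theorem norm_den_mul_sub_num_le {a : ℕ → GaussianInt} {z : ℂ} (h : IsExpansion a z) (n : ℕ) :
    ‖((numDen n a).2 : ℂ) * z - ((numDen n a).1 : ℂ)‖ ≤ √(1 / 2) ^ (n + 1) := by
  induction n generalizing a z with
  | zero => simpa [numDen] using norm_le_of_mem_square h.1
  | succ n ih =>
    have hz := h.ne_zero
    have e : ((numDen (n + 1) a).2 : ℂ) * z - ((numDen (n + 1) a).1 : ℂ) =
        -z * (((numDen n fun k => a (k + 1)).2 : ℂ) * gaussMap z -
          ((numDen n fun k => a (k + 1)).1 : ℂ)) := by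
      rw [h.gaussMap_eq]
      simp only [numDen, map_add, map_mul]
      field_simp
      ring
    rw [e, norm_mul, norm_neg, pow_succ']
    exact mul_le_mul (norm_le_of_mem_square h.1) (ih h.shift) (norm_nonneg _)
      (Real.sqrt_nonneg _)

theorem numDen_ne_zero (n : ℕ) (a : ℕ → GaussianInt) : numDen n a ≠ 0 := by
  induction n generalizing a with
  | zero => simp [numDen]
  | succ n ih =>
    intro h
    simp only [numDen, Prod.mk_eq_zero] at h
    obtain ⟨h1, h2⟩ := h
    rw [h1, mul_zero, zero_add] at h2
    exact ih _ (Prod.ext h2 h1)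

/-- If `q = 0`, then `p` is a nonzero Gaussian integer, so `|q z - p| ≥ 1`, against the estimate. -/
theorem IsExpansion.den_ne_zero {a : ℕ → GaussianInt} {z : ℂ} (h : IsExpansion a z) (n : ℕ) :
    (numDen n a).2 ≠ 0 := by
  intro h0
  have hb := norm_den_mul_sub_num_le h n
  have hn : (numDen n a).1 ≠ 0 := fun h1 => numDen_ne_zero n a (Prod.ext h1 h0)
  rw [h0, map_zero, zero_mul, zero_sub, norm_neg] at hb
  have := one_le_norm_toComplex hn
  have := pow_lt_one₀ (Real.sqrt_nonneg _) sqrt_half_lt_one n.succ_ne_zero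
  rw [Nat.succ_eq_add_one] at this
  linarith

theorem IsExpansion.convergent_eq {a : ℕ → GaussianInt} {z : ℂ} (h : IsExpansion a z) (n : ℕ) :
    convergent n a = ((numDen n a).1 : ℂ) / ((numDen n a).2 : ℂ) := by
  induction n generalizing a z with
  | zero => simp [convergent, numDen]
  | succ n ih =>
    have h0 : ((numDen n fun k => a (k + 1)).2 : ℂ) ≠ 0 := by
      simpa using h.shift.den_ne_zero n
    rw [convergent, ih h.shift]
    simp only [numDen, map_add, map_mul]
    rw [← inv_div (_ + _), add_div, mul_div_cancel_right₀ _ h0]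

theorem IsExpansion.dist_convergent_le {a : ℕ → GaussianInt} {z : ℂ} (h : IsExpansion a z)
    (n : ℕ) : dist (convergent n a) z ≤ √(1 / 2) ^ n := by
  have h0 : ((numDen n a).2 : ℂ) ≠ 0 := by simpa using h.den_ne_zero n
  have h1 := one_le_norm_toComplex (h.den_ne_zero n)
  have h2 : z - convergent n a =
      (((numDen n a).2 : ℂ) * z - ((numDen n a).1 : ℂ)) / ((numDen n a).2 : ℂ) := by
    rw [h.convergent_eq n]; field_simp
  rw [dist_comm, dist_eq_norm, h2, norm_div]
  calc _ ≤ ‖((numDen n a).2 : ℂ) * z - ((numDen n a).1 : ℂ)‖ := div_le_self (norm_nonneg _) h1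
    _ ≤ √(1 / 2) ^ (n + 1) := norm_den_mul_sub_num_le h n
    _ ≤ √(1 / 2) ^ n :=
      pow_le_pow_of_le_one (Real.sqrt_nonneg _) sqrt_half_lt_one.le n.le_succ

theorem tendsto_sqrt_half_pow : Tendsto (fun n : ℕ => √(1 / 2 : ℝ) ^ n) atTop (𝓝 0) :=
  tendsto_pow_atTop_nhds_zero_of_lt_one (Real.sqrt_nonneg _) sqrt_half_lt_one

theorem IsExpansion.tendsto_convergent {a : ℕ → GaussianInt} {z : ℂ} (h : IsExpansion a z) :
    Tendsto (fun n => convergent n a) atTop (𝓝 z) :=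
  tendsto_iff_dist_tendsto_zero.2 <|
    squeeze_zero (fun _ => dist_nonneg) h.dist_convergent_le tendsto_sqrt_half_pow

theorem IsExpansion.value_eq {a : validSeq} {z : ℂ} (h : IsExpansion a.1 z) : value a = z :=
  h.tendsto_convergent.limUnder_eq

theorem isExpansion_value (a : validSeq) : IsExpansion a.1 (value a) := by
  obtain ⟨z, hz⟩ := a.2.2
  rwa [hz.value_eq]

/-! ### The continuous extension -/

theorem isLocallyConstant_convergent (n : ℕ) : IsLocallyConstant (convergent n) := by
  induction n with
  | zero => exact IsLocallyConstant.const 0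
  | succ n ih =>
    have h0 : IsLocallyConstant fun a : ℕ → GaussianInt => a 0 :=
      (IsLocallyConstant.iff_continuous _).2 (continuous_apply 0)
    have h1 : IsLocallyConstant fun a : ℕ → GaussianInt => convergent n fun k => a (k + 1) :=
      ih.comp_continuous (continuous_pi fun k => continuous_apply (k + 1))
    exact (h0.prodMk h1).comp fun p : GaussianInt × ℂ => ((p.1 : ℂ) + p.2)⁻¹

/-- On `R` both convergents are close to the same point; the bound is a closed condition, so it
survives in the closure, where a sequence need not be an expansion. -/
theorem dist_convergent_le_of_mem_closure {a : ℕ → GaussianInt} (ha : a ∈ closure regularSeq)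
    {n m : ℕ} (hnm : n ≤ m) : dist (convergent n a) (convergent m a) ≤ 2 * √(1 / 2) ^ n := by
  have hc : IsClosed {a | dist (convergent n a) (convergent m a) ≤ 2 * √(1 / 2) ^ n} :=
    isClosed_le ((isLocallyConstant_convergent n).continuous.dist
      (isLocallyConstant_convergent m).continuous) continuous_const
  refine closure_minimal (fun b hb => ?_) hc ha
  obtain ⟨z, hz⟩ := hb.1.2
  have h1 := hz.dist_convergent_le n
  have h2 := hz.dist_convergent_le m
  have h3 := pow_le_pow_of_le_one (Real.sqrt_nonneg (1 / 2)) sqrt_half_lt_one.le hnm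
  have h4 := dist_triangle_right (convergent n b) (convergent m b) z
  rw [Set.mem_ofPred_eq]
  linarith

/-- The limit of the convergents of a sequence in the closure of the regular sequences. -/
noncomputable def extendedValue (a : closure regularSeq) : ℂ := limUnder atTop fun n => convergent n a.1

theorem tendsto_extendedValue (a : closure regularSeq) :
    Tendsto (fun n => convergent n a.1) atTop (𝓝 (extendedValue a)) := by
  refine CauchySeq.tendsto_limUnder <| cauchySeq_of_le_tendsto_0' (fun n => 2 * √(1 / 2) ^ n)
    (fun n m hnm => dist_convergent_le_of_mem_closure a.2 hnm) ?_
  simpa using tendsto_sqrt_half_pow.const_mul 2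

theorem continuous_extendedValue : Continuous extendedValue := by
  have hu : TendstoUniformly (fun n (a : closure regularSeq) => convergent n a.1)
      extendedValue atTop := by
    rw [Metric.tendstoUniformly_iff]
    intro ε hε
    have h0 : Tendsto (fun n : ℕ => 2 * √(1 / 2 : ℝ) ^ n) atTop (𝓝 0) := by
      simpa using tendsto_sqrt_half_pow.const_mul 2
    filter_upwards [h0.eventually_lt_const hε] with n hn a
    rw [dist_comm]
    refine lt_of_le_of_lt ?_ hn
    refine le_of_tendsto (tendsto_const_nhds.dist (tendsto_extendedValue a)) ?_
    filter_upwards [eventually_ge_atTop n] with m hm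
    exact dist_convergent_le_of_mem_closure a.2 hm
  exact hu.continuous (Frequently.of_forall fun n =>
    (isLocallyConstant_convergent n).continuous.comp continuous_subtype_val)

theorem isContinuousExtension_extendedValue : IsContinuousExtension extendedValue :=
  -- On `R` both maps are the same `limUnder` of convergents.
  ⟨continuous_extendedValue, fun _ _ => rfl⟩

theorem dense_regularSeq_in_closure :
    Dense {a : closure regularSeq | a.1 ∈ regularSeq} := by
  intro a
  rw [closure_subtype]
  have : Subtype.val '' {a : closure regularSeq | a.1 ∈ regularSeq} = regularSeq := by
    ext b
    exact ⟨by rintro ⟨c, hc, rfl⟩; exact hc, fun hb => ⟨⟨b, subset_closure hb⟩, hb, rfl⟩⟩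
  rw [this]
  exact a.2

theorem IsContinuousExtension.unique {L L' : closure regularSeq → ℂ}
    (h : IsContinuousExtension L) (h' : IsContinuousExtension L') : L' = L :=
  Continuous.ext_on dense_regularSeq_in_closure h'.1 h.1 fun a ha =>
    (h'.2 a.1 ha).trans (h.2 a.1 ha).symm

theorem IsContinuousExtension.range_subset {L : closure regularSeq → ℂ}
    (h : IsContinuousExtension L) : Set.range L ⊆ closure square := by
  rintro _ ⟨a, rfl⟩
  refine map_mem_closure h.1 (dense_regularSeq_in_closure a) fun b hb => ?_
  have := h.2 b.1 hb
  rw [show L b = value ⟨b.1, hb.1⟩ from this]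
  exact (isExpansion_value _).1

/-! ### Points whose orbit avoids the discontinuities -/

/-- The points where `nearest` may fail to be locally constant. -/
def gridLines : Set ℂ :=
  {z | ∃ m : ℤ, z.re + 1 / 2 = m} ∪ {z | ∃ m : ℤ, z.im + 1 / 2 = m}

/-- Points of the open square whose orbit avoids `0` and whose inverted orbit avoids the grid. -/
def genericPoints : Set ℂ :=
  {z | z ∈ interior square ∧ ∀ n, gaussMap^[n] z ≠ 0 ∧ (gaussMap^[n] z)⁻¹ ∉ gridLines}

theorem eventually_floor_eq {x : ℝ} (hx : ∀ m : ℤ, x ≠ m) : ∀ᶠ y in 𝓝 x, ⌊y⌋ = ⌊x⌋ := by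
  have h1 : (⌊x⌋ : ℝ) < x := lt_of_le_of_ne (Int.floor_le x) fun h => hx _ h.symm
  filter_upwards [Ioo_mem_nhds h1 (Int.lt_floor_add_one x)] with y hy
  exact Int.floor_eq_iff.2 ⟨hy.1.le, hy.2⟩

theorem eventually_nearest_eq {z : ℂ} (hz : z ∉ gridLines) :
    ∀ᶠ w in 𝓝 z, nearest w = nearest z := by
  have h1 : ∀ m : ℤ, z.re + 1 / 2 ≠ m := fun m h => hz (Or.inl ⟨m, h⟩)
  have h2 : ∀ m : ℤ, z.im + 1 / 2 ≠ m := fun m h => hz (Or.inr ⟨m, h⟩)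
  have c1 : ContinuousAt (fun w : ℂ => w.re + 1 / 2) z := by fun_prop
  have c2 : ContinuousAt (fun w : ℂ => w.im + 1 / 2) z := by fun_prop
  filter_upwards [c1.eventually (eventually_floor_eq h1),
    c2.eventually (eventually_floor_eq h2)] with w hw1 hw2
  simp only [nearest, hw1, hw2]

theorem continuousAt_gaussMap {z : ℂ} (h0 : z ≠ 0) (hz : z⁻¹ ∉ gridLines) :
    ContinuousAt gaussMap z := by
  have hi : ContinuousAt (fun w : ℂ => w⁻¹) z := continuousAt_inv₀ h0
  have : (fun w : ℂ => w⁻¹ - (nearest z⁻¹ : ℂ)) =ᶠ[𝓝 z] gaussMap := by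
    filter_upwards [hi.eventually (eventually_nearest_eq hz), eventually_ne_nhds h0] with w h1 h2
    rw [gaussMap_of_ne_zero h2, h1]
  exact ContinuousAt.congr (hi.sub continuousAt_const) this

theorem continuousAt_iterate_gaussMap {z : ℂ} (hz : z ∈ genericPoints) (n : ℕ) :
    ContinuousAt gaussMap^[n] z := by
  induction n with
  | zero => exact continuousAt_id
  | succ n ih =>
    rw [Function.iterate_succ']
    exact ContinuousAt.comp (continuousAt_gaussMap (hz.2 n).1 (hz.2 n).2) ih

/-- The sequence of partial quotients. -/
noncomputable def digits (z : ℂ) (n : ℕ) : GaussianInt := nearest (gaussMap^[n] z)⁻¹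

theorem isExpansion_digits {z : ℂ} (hz : z ∈ genericPoints) : IsExpansion (digits z) z :=
  ⟨interior_subset hz.1, fun n => ⟨(hz.2 n).1, rfl⟩⟩

/-- Iterates of `T` are continuous at a generic point, so all nearby points share its first `n`
digits: the point is interior to each of its cylinders. -/
theorem digits_mem_regularSeq {z : ℂ} (hz : z ∈ genericPoints) : digits z ∈ regularSeq := by
  have hal : ∀ n, digits z n ∈ alphabet := fun n =>
    nearest_inv_mem_alphabet (iterate_gaussMap_mem_square (interior_subset hz.1) n) (hz.2 n).1
  refine ⟨⟨hal, z, isExpansion_digits hz⟩, fun n _ => ⟨fun k => hal k, z, ?_⟩⟩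
  rw [mem_interior_iff_mem_nhds]
  have hd : ∀ k : Fin n, ∀ᶠ w in 𝓝 z, HasDigit w k (digits z k) := fun k => by
    have hk := continuousAt_iterate_gaussMap hz k
    have hi : ContinuousAt (fun w => (gaussMap^[k] w)⁻¹) z := hk.inv₀ (hz.2 k).1
    filter_upwards [hk.eventually_ne (hz.2 k).1,
      hi.eventually (eventually_nearest_eq (hz.2 k).2)] with w h1 h2
    exact ⟨h1, h2⟩
  filter_upwards [mem_interior_iff_mem_nhds.1 hz.1, eventually_all.2 hd] with w h1 h2
  exact ⟨h1, h2⟩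

/-! ### Almost every point of the open square is generic -/

theorem volume_re_eq (c : ℝ) : volume {z : ℂ | z.re = c} = 0 := by
  have h : {z : ℂ | z.re = c} = Complex.measurableEquivRealProd ⁻¹' ({c} ×ˢ Set.univ) := by
    ext z; simp
  rw [h, Complex.volume_preserving_equiv_real_prod.measure_preimage_equiv, Measure.volume_eq_prod,
    Measure.prod_prod]
  simp

theorem volume_im_eq (c : ℝ) : volume {z : ℂ | z.im = c} = 0 := by
  have h : {z : ℂ | z.im = c} = Complex.measurableEquivRealProd ⁻¹' (Set.univ ×ˢ {c}) := by
    ext z; simp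
  rw [h, Complex.volume_preserving_equiv_real_prod.measure_preimage_equiv, Measure.volume_eq_prod,
    Measure.prod_prod]
  simp

theorem volume_gridLines : volume gridLines = 0 := by
  have h : gridLines ⊆ (⋃ m : ℤ, {z : ℂ | z.re = m - 1 / 2}) ∪
      ⋃ m : ℤ, {z : ℂ | z.im = m - 1 / 2} := by
    rintro z (⟨m, hm⟩ | ⟨m, hm⟩)
    · exact Or.inl (Set.mem_iUnion.2 ⟨m, eq_sub_of_add_eq hm⟩)
    · exact Or.inr (Set.mem_iUnion.2 ⟨m, eq_sub_of_add_eq hm⟩)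
  refine measure_mono_null h (measure_union_null ?_ ?_)
  · exact measure_iUnion_null fun m => volume_re_eq _
  · exact measure_iUnion_null fun m => volume_im_eq _

theorem volume_preimage_inv {s : Set ℂ} (hs : volume s = 0) :
    volume {z : ℂ | z⁻¹ ∈ s} = 0 := by
  have h : {z : ℂ | z⁻¹ ∈ s} ⊆ {0} ∪ (fun z : ℂ => z⁻¹) '' (s \ {0}) := by
    intro z hz
    by_cases h0 : z = 0
    · exact Or.inl h0
    · exact Or.inr ⟨z⁻¹, ⟨hz, inv_ne_zero h0⟩, inv_inv z⟩
  refine measure_mono_null h (measure_union_null (by simp) ?_)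
  refine addHaar_image_eq_zero_of_differentiableOn_of_addHaar_eq_zero volume ?_
    (measure_mono_null Set.sdiff_subset hs)
  intro z hz
  have : DifferentiableAt ℂ (fun z : ℂ => z⁻¹) z := differentiableAt_inv hz.2
  exact (this.restrictScalars ℝ).differentiableWithinAt

theorem countable_gaussianInt : Countable GaussianInt :=
  Function.Injective.countable (f := fun a : GaussianInt => (a.re, a.im)) fun _ _ h =>
    Zsqrtd.ext (Prod.ext_iff.1 h).1 (Prod.ext_iff.1 h).2

/-- Away from `0`, `T` has countably many branches, each an inversion followed by a translation, and
these pull null sets back to null sets. -/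
theorem volume_preimage_gaussMap {s : Set ℂ} (hs : volume s = 0) :
    volume (gaussMap ⁻¹' s) = 0 := by
  have := countable_gaussianInt
  have h : gaussMap ⁻¹' s ⊆
      {0} ∪ ⋃ a : GaussianInt, {z : ℂ | z⁻¹ ∈ (fun w : ℂ => w + -(a : ℂ)) ⁻¹' s} := by
    intro z hz
    by_cases h0 : z = 0
    · exact Or.inl h0
    · refine Or.inr (Set.mem_iUnion.2 ⟨nearest z⁻¹, ?_⟩)
      rw [Set.mem_preimage, gaussMap_of_ne_zero h0, sub_eq_add_neg] at hz
      exact hz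
  refine measure_mono_null h (measure_union_null (by simp) (measure_iUnion_null fun a => ?_))
  apply volume_preimage_inv
  rwa [measure_preimage_add_right]

theorem volume_preimage_iterate_gaussMap {s : Set ℂ} (hs : volume s = 0) (n : ℕ) :
    volume (gaussMap^[n] ⁻¹' s) = 0 := by
  induction n with
  | zero => exact hs
  | succ n ih =>
    rw [Function.iterate_succ, Set.preimage_comp]
    exact volume_preimage_gaussMap ih

theorem volume_interior_square_diff_genericPoints :
    volume (interior square \ genericPoints) = 0 := by
  have hB : volume ({0} ∪ {z : ℂ | z⁻¹ ∈ gridLines}) = 0 :=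
    measure_union_null (by simp) (volume_preimage_inv volume_gridLines)
  refine measure_mono_null (t := ⋃ n, gaussMap^[n] ⁻¹' ({0} ∪ {z : ℂ | z⁻¹ ∈ gridLines}))
    (fun z hz => ?_) (measure_iUnion_null fun n => volume_preimage_iterate_gaussMap hB n)
  by_contra hn
  simp only [Set.mem_iUnion, not_exists] at hn
  exact hz.2 ⟨hz.1, fun n =>
    ⟨fun h => hn n (Or.inl h), fun h => hn n (Or.inr h)⟩⟩

theorem interior_square_subset_closure_genericPoints :
    interior square ⊆ closure genericPoints := by
  intro z hz
  rw [mem_closure_iff]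
  intro o ho hzo
  by_contra hne
  have hpos : 0 < volume (o ∩ interior square) :=
    (ho.inter isOpen_interior).measure_pos volume ⟨z, hzo, hz⟩
  have hsub : o ∩ interior square ⊆ interior square \ genericPoints :=
    fun w hw => ⟨hw.2, fun hg => hne ⟨w, hw.1, hg⟩⟩
  exact hpos.ne' (measure_mono_null hsub volume_interior_square_diff_genericPoints)

theorem square_eq_preimage_prod :
    square = Complex.equivRealProdCLM ⁻¹'
      (Set.Ico (-(1 / 2)) (1 / 2) ×ˢ Set.Ico (-(1 / 2)) (1 / 2)) := by
  ext z
  rw [mem_square_iff]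
  simp

theorem square_subset_closure_interior : square ⊆ closure (interior square) := by
  have hc : Convex ℝ square := by
    rw [square_eq_preimage_prod]
    exact ((convex_Ico _ _).prod (convex_Ico _ _)).linear_preimage
      Complex.equivRealProdCLM.toLinearMap
  have h0 : (interior square).Nonempty := by
    refine ⟨0, mem_interior_iff_mem_nhds.2 ?_⟩
    rw [square_eq_preimage_prod]
    refine Complex.equivRealProdCLM.continuous.continuousAt.preimage_mem_nhds ?_
    rw [map_zero]
    exact prod_mem_nhds (Ico_mem_nhds (by norm_num) (by norm_num))
      (Ico_mem_nhds (by norm_num) (by norm_num))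
  rw [hc.closure_interior_eq_closure_of_nonempty_interior h0]
  exact subset_closure

theorem square_subset_closure_genericPoints : square ⊆ closure genericPoints :=
  square_subset_closure_interior.trans
    (closure_minimal interior_square_subset_closure_genericPoints isClosed_closure)

/-! ### The image of the extension -/

theorem mem_gaussianRationals_of_inv_sub {w : ℂ} {a : GaussianInt}
    (h : w⁻¹ - (a : ℂ) ∈ gaussianRationals) : w ∈ gaussianRationals := by
  obtain ⟨p, q, hpq⟩ := h
  have hw : w⁻¹ = ((p + a.re : ℚ) : ℂ) + ((q + a.im : ℚ) : ℂ) * Complex.I := by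
    rw [sub_eq_iff_eq_add.1 hpq, GaussianInt.toComplex_def]
    push_cast
    ring
  rw [← inv_inv w, hw]
  generalize p + a.re = x
  generalize q + a.im = y
  -- The coordinates of `(x + i y)⁻¹`; the case `x = y = 0` is covered by the convention that
  -- division by `0` gives `0`.
  refine ⟨x / (x ^ 2 + y ^ 2), -y / (x ^ 2 + y ^ 2), ?_⟩
  apply Complex.ext
  · simp [Complex.inv_re, Complex.normSq_apply, pow_two]
    norm_cast
    simp
  · simp [Complex.inv_im, Complex.normSq_apply, pow_two]
    norm_cast
    simp

theorem ne_zero_of_notMem_gaussianRationals {w : ℂ} (h : w ∉ gaussianRationals) : w ≠ 0 := by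
  rintro rfl
  exact h ⟨0, 0, by simp⟩

theorem finite_nearest_image_ball (z : ℂ) : (nearest '' Metric.ball z 1).Finite := by
  have hfin := ((Set.finite_Icc ⌊z.re - 1⌋ ⌊z.re + 2⌋).prod
    (Set.finite_Icc ⌊z.im - 1⌋ ⌊z.im + 2⌋)).preimage
    (f := fun a : GaussianInt => (a.re, a.im)) (fun _ _ _ _ h =>
      Zsqrtd.ext (Prod.ext_iff.1 h).1 (Prod.ext_iff.1 h).2)
  refine hfin.subset ?_
  rintro _ ⟨w, hw, rfl⟩
  rw [Metric.mem_ball, dist_eq_norm] at hw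
  have h1 := abs_lt.1 ((Complex.abs_re_le_norm (w - z)).trans_lt hw)
  have h2 := abs_lt.1 ((Complex.abs_im_le_norm (w - z)).trans_lt hw)
  rw [Complex.sub_re] at h1
  rw [Complex.sub_im] at h2
  refine ⟨⟨Int.floor_mono ?_, Int.floor_mono ?_⟩, Int.floor_mono ?_, Int.floor_mono ?_⟩ <;>
    linarith [h1.1, h1.2, h2.1, h2.2]

/-- An ultrafilter containing a finite set is principal, so the nearest integer stabilises even when
`w` lies on a discontinuity line. -/
theorem exists_eventually_nearest_eq {α : Type*} (U : Ultrafilter α) {f : α → ℂ} {w : ℂ}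
    (hf : Tendsto f U (𝓝 w)) : ∃ a, ∀ᶠ x in (U : Filter α), nearest (f x) = a := by
  have hmem : nearest '' Metric.ball w 1 ∈ (U.map fun x => nearest (f x)) := by
    rw [Ultrafilter.mem_map]
    filter_upwards [hf.eventually (Metric.ball_mem_nhds w one_pos)] with x hx
    exact ⟨f x, hx, rfl⟩
  obtain ⟨a, -, ha⟩ := Ultrafilter.eq_pure_of_finite_mem (finite_nearest_image_ball w) hmem
  refine ⟨a, ?_⟩
  have : {a} ∈ U.map fun x => nearest (f x) := by rw [ha]; exact Set.mem_singleton a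
  exact this

/-- The limit `w` need not be `T^n z`, since the orbit of `z` may meet discontinuities. Staying
outside `ℚ(i)` keeps `w` nonzero, so the inverses converge and the induction continues. -/
theorem exists_tendsto_iterate_gaussMap {z : ℂ} (hz : z ∉ gaussianRationals) (U : Ultrafilter ℂ)
    (hU : (U : Filter ℂ) ≤ 𝓝 z) (hG : genericPoints ∈ U) (n : ℕ) :
    ∃ w, w ∉ gaussianRationals ∧ Tendsto gaussMap^[n] U (𝓝 w) := by
  induction n with
  | zero => exact ⟨z, hz, hU⟩
  | succ n ih =>
    obtain ⟨w, hw, ht⟩ := ih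
    have hinv := ht.inv₀ (ne_zero_of_notMem_gaussianRationals hw)
    obtain ⟨a, ha⟩ := exists_eventually_nearest_eq U hinv
    refine ⟨w⁻¹ - (a : ℂ), fun h => hw (mem_gaussianRationals_of_inv_sub h), ?_⟩
    refine (hinv.sub_const (a : ℂ)).congr' ?_
    filter_upwards [ha, hG] with x hx hxG
    rw [Function.iterate_succ_apply', gaussMap_of_ne_zero (hxG.2 n).1, hx]

theorem IsContinuousExtension.mem_range {L : closure regularSeq → ℂ}
    (hL : IsContinuousExtension L) {z : ℂ} (hz : z ∈ square) (hq : z ∉ gaussianRationals) :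
    z ∈ Set.range L := by
  obtain ⟨U, hG, hU⟩ := mem_closure_iff_ultrafilter.1 (square_subset_closure_genericPoints hz)
  have hd : ∀ n, ∃ a, ∀ᶠ x in (U : Filter ℂ), digits x n = a := fun n => by
    obtain ⟨w, hw, ht⟩ := exists_tendsto_iterate_gaussMap hq U hU hG n
    exact exists_eventually_nearest_eq U (ht.inv₀ (ne_zero_of_notMem_gaussianRationals hw))
  choose b hb using hd
  have ht : Tendsto digits U (𝓝 b) := tendsto_pi_nhds.2 fun n =>
    tendsto_const_nhds.congr' (by filter_upwards [hb n] with x hx using hx.symm)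
  have hbc : b ∈ closure regularSeq :=
    mem_closure_of_tendsto ht (by filter_upwards [hG] with x hx using digits_mem_regularSeq hx)
  refine ⟨⟨b, hbc⟩, ?_⟩
  have hLb := hL.1.tendsto ⟨b, hbc⟩
  rw [nhds_subtype_eq_comap] at hLb
  -- For generic `x`, `L` sends the digits of `x` back to `x`; so continuity of `L` at `b` makes `U`
  -- converge to `L b` as well as to `z`.
  have key : ∀ s ∈ 𝓝 (L ⟨b, hbc⟩), ∀ᶠ x in (U : Filter ℂ), x ∈ s := fun s hs => by
    obtain ⟨t, htb, hts⟩ := mem_comap.1 (hLb hs)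
    filter_upwards [ht htb, hG] with x hx hxG
    have hr := digits_mem_regularSeq hxG
    have h1 : L ⟨digits x, subset_closure hr⟩ ∈ s := @hts ⟨digits x, subset_closure hr⟩ hx
    rwa [hL.2 _ hr, (show IsExpansion (Subtype.val ⟨digits x, hr.1⟩) x from
      isExpansion_digits hxG).value_eq] at h1
  exact tendsto_nhds_unique (f := id) (l := (U : Filter ℂ)) key hU

end HurwitzCF

theorem mainTheorem9 :
    (∀ a : HurwitzCF.validSeq,
      HurwitzCF.IsExpansion a.1 (HurwitzCF.value a) ∧
      Tendsto (fun n => HurwitzCF.convergent n a.1) atTop (𝓝 (HurwitzCF.value a))) ∧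
    ∃ L : closure HurwitzCF.regularSeq → ℂ,
      HurwitzCF.IsContinuousExtension L ∧
      (∀ L' : closure HurwitzCF.regularSeq → ℂ,
        HurwitzCF.IsContinuousExtension L' → L' = L) ∧
      Set.range L ⊆ closure HurwitzCF.square ∧
      HurwitzCF.square \ HurwitzCF.gaussianRationals ⊆ Set.range L := by
  open HurwitzCF in
  exact ⟨fun a => ⟨isExpansion_value a, (isExpansion_value a).tendsto_convergent⟩,
    extendedValue, isContinuousExtension_extendedValue,
    fun _ h => isContinuousExtension_extendedValue.unique h,
    isContinuousExtension_extendedValue.range_subset,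
    fun _ hz => isContinuousExtension_extendedValue.mem_range hz.1 hz.2⟩
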